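/- Let $T>0$ and let $\alpha,\beta>0$ with $\alpha+\beta>1$. Let $X=(X_t)_{t\in[0,T]}$ and $Y=(Y_t)_{t\in[0,T]}$ be real-valued random processes on a common probability space whose paths are almost surely Hölder continuous on $[0,T]$ of orders $\alpha$ and $\beta$, respectively. Assume that there is an integrable function $t\mapsto\hat p_t$ on $[0,T]$ such that for almost every $t\in[0,T]$ the random variable $X_t$ admits a probability density function $p_t$ with $\sup_{y\in\mathbb{R}}p_t(y)\le\hat p_t$. Then for every $f:\mathbb{R}\to\mathbb{R}$ of locally finite variation such that the limit $f(X_{0+})=\lim_{t\downarrow 0}f(X_t)$ exists in $\mathbb{R}$ almost surely, the pathwise fractional Zähle--Stieltjes integral \[ \text{(ZS)}\int_0^T f(X_t)\,dY_t \] exists almost surely. Here, for functions $h,g$ measurable on $(a,b)$, the integral $\text{(ZS)}\int_a^b h\,dg$ exists if the limits $h(a+),g(a+),g(b-)$ exist in $\mathbb{R}$; there are $\gamma\in[0,1]$, $p,q\in[1,\infty]$ with $1/p+1/q=1$, $\varphi\in L_p(a,b)$ and $\psi\in L_q(a,b)$ such that almost everywhere on $(a,b)$ \[ h-h(a+)=I^{\gamma}_{a+}\varphi,\qquad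 g-g(b-)=I^{1-\gamma}_{b-}\psi ; \] and the number \[ -\int_a^b \varphi(t)\psi(t)\,dt+h(a+)\bigl(g(b-)-g(a+)\bigr) \] is the same for all such choices of $\gamma,p,q,\varphi,\psi$; this number is the value of the integral. The fractional integrals are $I^{\gamma}_{a+}\varphi(t)=\frac1{\Gamma(\gamma)}\int_a^t\varphi(s)(t-s)^{\gamma-1}\,ds$ and $I^{\gamma}_{b-}\psi(t)=\frac1{\Gamma(\gamma)}\int_t^b\psi(s)(s-t)^{\gamma-1}\,ds$ for $\gamma>0$, and $I^0_{a+},I^0_{b-}$ are the identity. (If the phase $(-1)^{-\gamma}=e^{-i\pi\gamma}$ is included in the right-sided fractional integral $I^\gamma_{b-}$, the value reads $(-1)^{\gamma}\int_a^b D^{\gamma}_{a+}(h-h(a+))\,D^{1-\gamma}_{b-}(g-g(b-))\,dt+h(a+)(g(b-)-g(a+))$, where $D$ denotes the inverses of the fractional integrals; the phases multiply to $-1$.) -/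

import Mathlib

open MeasureTheory Set Filter Topology
open scoped NNReal ENNReal

namespace ZahleStieltjes

noncomputable section

/-- Left-sided Riemann-Liouville integral of order `γ ≥ 0` based at `a`; the identity for `γ = 0`.
For `φ` integrable on `(a, b)` the integral converges for almost every `t` in `(a, b)`. -/
def leftRL (a γ : ℝ) (φ : ℝ → ℝ) (t : ℝ) : ℝ :=
  if γ = 0 then φ t
  else (Real.Gamma γ)⁻¹ * ∫ s in Ioo a t, φ s * (t - s) ^ (γ - 1)

/-- Right-sided Riemann-Liouville integral of order `γ ≥ 0` based at `b`; the identity for `γ = 0`.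
The formal phase `(-1) ^ (-γ) = exp (-i π γ)`, which some authors include here, is left out;
its effect on the Stieltjes integral is the sign that appears in `HasZSIntegral`. -/
def rightRL (b γ : ℝ) (φ : ℝ → ℝ) (t : ℝ) : ℝ :=
  if γ = 0 then φ t
  else (Real.Gamma γ)⁻¹ * ∫ s in Ioo t b, φ s * (s - t) ^ (γ - 1)

/-- `φ ∈ L_p(a, b)` is the left-sided Riemann-Liouville derivative of order `γ` of `f`,
that is, `f = I^γ_{a+} φ` almost everywhere on `(a, b)`. In particular `f ∈ I^γ_{a+}(L_p)`. -/
def IsLeftDeriv (a b γ : ℝ) (p : ℝ≥0∞) (f φ : ℝ → ℝ) : Prop :=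
  MemLp φ p (volume.restrict (Ioo a b)) ∧ f =ᵐ[volume.restrict (Ioo a b)] leftRL a γ φ

/-- `ψ ∈ L_q(a, b)` is the (phase-free) right-sided Riemann-Liouville derivative of order `γ`
of `g`, that is, `g = I^γ_{b-} ψ` almost everywhere on `(a, b)`. -/
def IsRightDeriv (a b γ : ℝ) (q : ℝ≥0∞) (g ψ : ℝ → ℝ) : Prop :=
  MemLp ψ q (volume.restrict (Ioo a b)) ∧ g =ᵐ[volume.restrict (Ioo a b)] rightRL b γ ψ

/-- `v` is a value of the fractional Zähle-Stieltjes integral `(ZS) ∫_a^b f dg`: the functions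
are measurable on `(a, b)`, the limits `f(a+)`, `g(a+)`, `g(b-)` exist in `ℝ`, and for some
`γ ∈ [0, 1]` and conjugate `p, q ∈ [1, ∞]` we have `f - f(a+) ∈ I^γ_{a+}(L_p)`,
`g - g(b-) ∈ I^{1-γ}_{b-}(L_q)`, and
`v = (-1)^γ ∫_a^b D^γ_{a+}(f - f(a+)) D^{1-γ}_{b-}(g - g(b-)) dt + f(a+) (g(b-) - g(a+))`.
The phases `(-1)^γ` in front and `(-1)^(1-γ)` in the right-sided derivative multiply to `-1`. -/
def HasZSIntegral (f g : ℝ → ℝ) (a b v : ℝ) : Prop :=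
  Measurable (fun t : Ioo a b => f t) ∧ Measurable (fun t : Ioo a b => g t) ∧
  ∃ fa ga gb : ℝ,
    Tendsto f (𝓝[>] a) (𝓝 fa) ∧ Tendsto g (𝓝[>] a) (𝓝 ga) ∧ Tendsto g (𝓝[<] b) (𝓝 gb) ∧
    ∃ γ ∈ Icc (0 : ℝ) 1, ∃ p q : ℝ≥0∞, p.HolderConjugate q ∧
      ∃ φ ψ : ℝ → ℝ,
        IsLeftDeriv a b γ p (fun t => f t - fa) φ ∧
        IsRightDeriv a b (1 - γ) q (fun t => g t - gb) ψ ∧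
        v = -(∫ t in Ioo a b, φ t * ψ t) + fa * (gb - ga)

/-- The fractional Zähle-Stieltjes integral `(ZS) ∫_a^b f dg` exists: the limits and the fractional
derivatives in its definition exist for some order and some pair of conjugate exponents, and the
resulting value does not depend on their choice. -/
def ZSIntegralExists (f g : ℝ → ℝ) (a b : ℝ) : Prop :=
  ∃! v : ℝ, HasZSIntegral f g a b v

variable {Ω : Type*} [MeasurableSpace Ω]

/-- `X` is a real random process on `[0, T]` whose paths are almost surely Hölder continuous of
order `α` (with a random Hölder constant). -/
def IsHolderProcess (P : Measure Ω) (T : ℝ) (α : ℝ≥0) (X : ℝ → Ω → ℝ) : Prop :=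
  (∀ t ∈ Icc 0 T, Measurable (X t)) ∧
    ∀ᵐ ω ∂P, ∃ C : ℝ≥0, HolderOnWith C α (fun t => X t ω) (Icc 0 T)

/-- For almost every `t ∈ [0, T]` the random variable `X t` has a probability density function
bounded by `phat t`, where `phat` is integrable on `[0, T]`. -/
def HasBoundedDensities (P : Measure Ω) (T : ℝ) (X : ℝ → Ω → ℝ) : Prop :=
  ∃ phat : ℝ → ℝ, IntegrableOn phat (Icc 0 T) ∧
    ∀ᵐ t ∂(volume.restrict (Icc 0 T)), ∃ p : ℝ → ℝ, Measurable p ∧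
      (∀ y, 0 ≤ p y ∧ p y ≤ phat t) ∧
      P.map (X t) = volume.withDensity (fun y => ENNReal.ofReal (p y))

end

end ZahleStieltjes

namespace ZahleStieltjes

/-! Existence: write `f` as a difference of monotone `m₁, m₂`. If `X` is `α`-Hölder with constant
`N`, then `|m (X t) - m (X (t - u))|` is at most the increment of `m` over the ball of radius `N u ^
α` around `X t`. Integrated over starting points in `[-N, N]`, this increment is `O(u ^ α)`
(`lintegral_monotone_increment_le`), so against `u ^ (-1 - γ)` it stays finite for `γ < α`. The
density bound transfers this to the occupation measure of `X`
(`HasBoundedDensities.ae_lintegral_comp_lt_top`). Hence almost surely `f ∘ X - l`, with `l` the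
limit of `f ∘ X` at `0+`, has an integrable Marchaud derivative of order `γ`. The Hölder path `Y`
has a bounded derivative of order `1 - γ` as soon as `1 - γ < β`. As `α + β > 1`, some `γ` satisfies
both, and the exponents are `p = 1`, `q = ∞`.

Independence of choices: reflect the integrator by `t ↦ T - t`, so that both fractional integrals
become causal convolutions. With `Φ, Ψ` the derivatives, the semigroup law gives `h * g = (Φ * Ψ) *
1` below `T`, whatever the order (`cv_ae_eq_of_isLeftDeriv`). Differentiation determines `Φ * Ψ`
almost everywhere, continuity determines it everywhere, and its value at `T` is `∫ φ ψ`. -/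

/-! ### Convolution of causal functions -/

/-- Convolution of real functions on the line. -/
noncomputable def cv (f g : ℝ → ℝ) : ℝ → ℝ :=
  convolution f g (ContinuousLinearMap.mul ℝ ℝ) volume

/-- Integrable functions on the line that vanish on the negative half-line. -/
structure Causal (f : ℝ → ℝ) : Prop where
  integrable : Integrable f
  eq_zero : ∀ x ≤ 0, f x = 0

/-- The truncated Riemann-Liouville kernel. -/
noncomputable def kern (T γ : ℝ) : ℝ → ℝ :=
  (Ioo 0 T).indicator fun x => (Real.Gamma γ)⁻¹ * x ^ (γ - 1)

/-- The truncated Heaviside function. -/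
noncomputable def heav (T : ℝ) : ℝ → ℝ := (Ioo 0 T).indicator fun _ => 1

theorem cv_apply (f g : ℝ → ℝ) (x : ℝ) : cv f g x = ∫ s, f s * g (x - s) := rfl

theorem cv_apply_swap (f g : ℝ → ℝ) (x : ℝ) : cv f g x = ∫ s, f (x - s) * g s :=
  convolution_mul_swap

theorem cv_comm (f g : ℝ → ℝ) : cv f g = cv g f := by
  ext x
  rw [cv_apply, cv_apply_swap]
  simp only [mul_comm]

theorem Causal.cv {f g : ℝ → ℝ} (hf : Causal f) (hg : Causal g) : Causal (cv f g) where
  integrable := hf.integrable.integrable_convolution _ hg.integrable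
  eq_zero x hx := by
    rw [cv_apply]
    refine integral_eq_zero_of_ae (Eventually.of_forall fun s => ?_)
    rcases le_or_gt s 0 with h | h
    · simp [hf.eq_zero s h]
    · simp [hg.eq_zero (x - s) (by linarith)]

theorem cv_assoc_ae {f g k : ℝ → ℝ} (hf : Integrable f) (hg : Integrable g) (hk : Integrable k) :
    cv (cv f g) k =ᵐ[volume] cv f (cv g k) := by
  have h3 := hf.norm.ae_convolution_exists (ContinuousLinearMap.mul ℝ ℝ)
    (hg.norm.integrable_convolution (ContinuousLinearMap.mul ℝ ℝ) hk.norm)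
  filter_upwards [h3] with x hx
  exact convolution_assoc _ _ _ _ (fun a b c => by simp [mul_assoc]) hf.1 hg.1 hk.1
    (hf.ae_convolution_exists _ hg) (hg.norm.ae_convolution_exists _ hk.norm) hx

/-- For `x ≤ T` the causal factor vanishes at `x - s` when `s ≥ T`. Values beyond `T` are never
seen, which is why truncated kernels suffice. -/
theorem cv_congr_left {T : ℝ} {f f' g : ℝ → ℝ} (hg : Causal g)
    (h : f =ᵐ[volume.restrict (Iio T)] f') {x : ℝ} (hx : x ≤ T) : cv f g x = cv f' g x := by
  rw [cv_apply, cv_apply]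
  refine integral_congr_ae ?_
  filter_upwards [(ae_restrict_iff' measurableSet_Iio).1 h] with s hs
  rcases lt_or_ge s T with h | h
  · rw [hs h]
  · simp [hg.eq_zero (x - s) (by linarith)]

theorem cv_congr_left_ae {T : ℝ} {f f' g : ℝ → ℝ} (hg : Causal g)
    (h : f =ᵐ[volume.restrict (Iio T)] f') :
    cv f g =ᵐ[volume.restrict (Iio T)] cv f' g := by
  filter_upwards [ae_restrict_mem measurableSet_Iio] with x hx
  exact cv_congr_left hg h (le_of_lt hx)

theorem cv_congr_right_ae {T : ℝ} {f f' g : ℝ → ℝ} (hg : Causal g)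
    (h : f =ᵐ[volume.restrict (Iio T)] f') :
    cv g f =ᵐ[volume.restrict (Iio T)] cv g f' := by
  rw [cv_comm g f, cv_comm g f']
  exact cv_congr_left_ae hg h

theorem causal_indicator {T : ℝ} {f : ℝ → ℝ} (hf : IntegrableOn f (Ioo 0 T)) :
    Causal ((Ioo 0 T).indicator f) where
  integrable := (integrable_indicator_iff measurableSet_Ioo).2 hf
  eq_zero x hx := indicator_of_notMem (fun h => by linarith [h.1]) _

/-! ### Riemann-Liouville kernels and the semigroup law -/

theorem integrableOn_rpow_Ioo {T r : ℝ} (hr : -1 < r) :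
    IntegrableOn (fun x : ℝ => x ^ r) (Ioo 0 T) := by
  rcases le_or_gt T 0 with h | h
  · simp [Ioo_eq_empty_of_le h]
  · exact (intervalIntegral.integrableOn_Ioo_rpow_iff h).2 hr

theorem causal_kern {T γ : ℝ} (hγ : 0 < γ) : Causal (kern T γ) :=
  causal_indicator ((integrableOn_rpow_Ioo (by linarith)).const_mul _)

theorem causal_heav (T : ℝ) : Causal (heav T) :=
  causal_indicator (by simp)

theorem kern_one (T : ℝ) : kern T 1 = heav T := by
  simp [kern, heav]

/-- Rescaled Beta integral `B(γ, 1 - γ)`; the power of `x` has exponent zero. -/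
theorem integral_rpow_mul_rpow {γ x : ℝ} (h0 : 0 < γ) (h1 : γ < 1) (hx : 0 < x) :
    ∫ s in Ioo 0 x, s ^ (γ - 1) * (x - s) ^ (-γ) = Real.Gamma γ * Real.Gamma (1 - γ) := by
  have h := Complex.betaIntegral_scaled γ (1 - γ : ℝ) hx
  have h2 := Complex.Gamma_mul_Gamma_eq_betaIntegral (s := γ) (t := (1 - γ : ℝ)) (by simpa)
    (by simpa)
  have e1 : (γ : ℂ) + (1 - γ : ℝ) = 1 := by push_cast; ring
  rw [e1] at h h2
  rw [Complex.Gamma_one, one_mul] at h2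
  rw [sub_self, Complex.cpow_zero, one_mul, ← h2, Complex.Gamma_ofReal, Complex.Gamma_ofReal,
    intervalIntegral.integral_of_le hx.le, integral_Ioc_eq_integral_Ioo] at h
  rw [← Complex.ofReal_inj, ← integral_complex_ofReal, Complex.ofReal_mul, ← h]
  refine setIntegral_congr_fun measurableSet_Ioo fun s hs => ?_
  have h3 : 0 ≤ x - s := by linarith [hs.2]
  rw [Complex.ofReal_mul, Complex.ofReal_cpow hs.1.le, Complex.ofReal_cpow h3]
  push_cast
  congr 2
  ring

theorem cv_kern_eq_setIntegral {T γ x : ℝ} {f : ℝ → ℝ} (hf : ∀ s ≤ 0, f s = 0) (hx : x ≤ T) :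
    cv f (kern T γ) x = (Real.Gamma γ)⁻¹ * ∫ s in Ioo 0 x, f s * (x - s) ^ (γ - 1) := by
  rw [cv_apply, ← integral_const_mul, ← integral_indicator measurableSet_Ioo]
  congr 1
  ext s
  by_cases h0 : s ≤ 0
  · rw [hf s h0, zero_mul, indicator_of_notMem fun h => absurd h.1 h0.not_gt]
  by_cases h1 : s < x
  · rw [indicator_of_mem (show s ∈ Ioo 0 x from ⟨by linarith, h1⟩), kern,
      indicator_of_mem (show x - s ∈ Ioo 0 T from ⟨by linarith, by linarith⟩)]
    ring
  · rw [indicator_of_notMem (fun h => h1 h.2), kern, indicator_of_notMem, mul_zero]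
    exact fun h => by linarith [h.1]

theorem cv_heav_eq_setIntegral {T x : ℝ} {f : ℝ → ℝ} (hf : ∀ s ≤ 0, f s = 0) (hx : x ≤ T) :
    cv f (heav T) x = ∫ s in Ioo 0 x, f s := by
  rw [← kern_one, cv_kern_eq_setIntegral hf hx]
  simp

theorem cv_kern_kern {T γ x : ℝ} (h0 : 0 < γ) (h1 : γ < 1) (hx : 0 < x) (hxT : x < T) :
    cv (kern T γ) (kern T (1 - γ)) x = 1 := by
  rw [cv_kern_eq_setIntegral (causal_kern h0).eq_zero hxT.le]
  have : ∫ s in Ioo 0 x, kern T γ s * (x - s) ^ (1 - γ - 1) =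
      (Real.Gamma γ)⁻¹ * ∫ s in Ioo 0 x, s ^ (γ - 1) * (x - s) ^ (-γ) := by
    rw [← integral_const_mul]
    refine setIntegral_congr_fun measurableSet_Ioo fun s hs => ?_
    rw [kern, indicator_of_mem (show s ∈ Ioo 0 T from ⟨hs.1, hs.2.trans hxT⟩),
      show 1 - γ - 1 = -γ by ring]
    ring
  rw [this, integral_rpow_mul_rpow h0 h1 hx]
  have := (Real.Gamma_pos_of_pos h0).ne'
  have := (Real.Gamma_pos_of_pos (sub_pos.2 h1)).ne'
  field_simp

theorem cv_kern_kern_ae {T γ : ℝ} (h0 : 0 < γ) (h1 : γ < 1) :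
    cv (kern T γ) (kern T (1 - γ)) =ᵐ[volume.restrict (Iio T)] heav T := by
  filter_upwards [ae_restrict_mem measurableSet_Iio] with x hx
  rcases le_or_gt x 0 with h | h
  · rw [((causal_kern h0).cv (causal_kern (sub_pos.2 h1))).eq_zero x h, (causal_heav T).eq_zero x h]
  · rw [cv_kern_kern h0 h1 h hx, heav, indicator_of_mem (show x ∈ Ioo 0 T from ⟨h, hx⟩)]

/-- Convolution with the Heaviside function is taking primitives, so Lebesgue differentiation undoes
it. -/
theorem ae_eq_of_cv_heav {T : ℝ} {f g : ℝ → ℝ} (hf : Causal f) (hg : Causal g)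
    (h : cv f (heav T) =ᵐ[volume.restrict (Iio T)] cv g (heav T)) :
    f =ᵐ[volume.restrict (Iio T)] g := by
  have hd : Integrable (fun s => f s - g s) := hf.integrable.sub hg.integrable
  have key : ∀ᵐ x, x ∈ Iio T → ∫ s in (0 : ℝ)..x, (f s - g s) = 0 := by
    filter_upwards [(ae_restrict_iff' measurableSet_Iio).1 h] with x hx hxT
    rcases le_or_gt x 0 with h0 | h0
    · refine intervalIntegral.integral_zero_ae (Eventually.of_forall fun s hs => ?_)
      rw [uIoc_of_ge h0] at hs
      simp [hf.eq_zero s hs.2, hg.eq_zero s hs.2]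
    · have := hx hxT
      rw [cv_heav_eq_setIntegral hf.eq_zero (le_of_lt hxT),
        cv_heav_eq_setIntegral hg.eq_zero (le_of_lt hxT)] at this
      rw [intervalIntegral.integral_of_le h0.le, integral_Ioc_eq_integral_Ioo,
        integral_sub hf.integrable.integrableOn hg.integrable.integrableOn, this, sub_self]
  have hcont : Continuous fun x => ∫ s in (0 : ℝ)..x, (f s - g s) :=
    intervalIntegral.continuous_primitive (fun a b => hd.intervalIntegrable) 0
  have hz : EqOn (fun x => ∫ s in (0 : ℝ)..x, (f s - g s)) (fun _ => 0) (Iio T) :=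
    Measure.eqOn_open_of_ae_eq ((ae_restrict_iff' measurableSet_Iio).2 key) isOpen_Iio
      hcont.continuousOn continuousOn_const
  rw [EventuallyEq, ae_restrict_iff' measurableSet_Iio]
  filter_upwards [LocallyIntegrable.ae_hasDerivAt_integral hd.locallyIntegrable] with x hx hxT
  have h1 : HasDerivAt (fun x => ∫ s in (0 : ℝ)..x, (f s - g s)) 0 x :=
    (hasDerivAt_const x (0 : ℝ)).congr_of_eventuallyEq (hz.eventuallyEq_of_mem (Iio_mem_nhds hxT))
  exact sub_eq_zero.1 ((hx 0).unique h1)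

/-! ### Uniqueness of the integral value -/

/-- The value at `x` is the `L_p`-`L_q` pairing of `f` with a reflected translate of `g`, and
translation is continuous in `L_q` for finite `q`. -/
theorem continuous_cv_of_ne_top {p q : ℝ≥0∞} (hpq : p.HolderConjugate q) (hq : q ≠ ∞)
    {f g : ℝ → ℝ} (hf : MemLp f p) (hg : MemLp g q) : Continuous (cv f g) := by
  have : Fact (1 ≤ p) := ⟨ENNReal.HolderConjugate.one_le p q⟩
  have : Fact (1 ≤ q) := ⟨ENNReal.HolderConjugate.one_le q p⟩
  let R : C(ℝ, C(ℝ, ℝ)) := (ContinuousMap.mk (fun z : ℝ × ℝ => z.1 - z.2) (by fun_prop)).curry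
  have hR : ∀ x, MeasurePreserving (R x) volume volume := fun x =>
    Measure.measurePreserving_sub_left volume x
  have hc : Continuous fun x => Lp.compMeasurePreserving (R x) (hR x) (hg.toLp g) :=
    continuous_const.compMeasurePreservingLp R.continuous hR hq
  have he : cv f g = fun x => (ContinuousLinearMap.mul ℝ ℝ).lpPairing volume p q (hf.toLp f)
      (Lp.compMeasurePreserving (R x) (hR x) (hg.toLp g)) := by
    ext x
    rw [ContinuousLinearMap.lpPairing_eq_integral, Lp.toLp_compMeasurePreserving, cv_apply]
    refine integral_congr_ae ?_
    filter_upwards [hf.coeFn_toLp, (hg.comp_measurePreserving (hR x)).coeFn_toLp] with s h1 h2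
    rw [h1, h2]
    rfl
  rw [he]
  exact (ContinuousLinearMap.continuous _).comp hc

theorem continuous_cv {p q : ℝ≥0∞} (hpq : p.HolderConjugate q)
    {f g : ℝ → ℝ} (hf : MemLp f p) (hg : MemLp g q) : Continuous (cv f g) := by
  by_cases hq : q = ∞
  · rw [cv_comm]
    refine continuous_cv_of_ne_top hpq.symm ?_ hg hf
    -- Conjugate exponents cannot both be infinite.
    have := ENNReal.HolderConjugate.lt_top_iff_one_lt q p
    subst hq
    rintro rfl
    simp at this
  · exact continuous_cv_of_ne_top hpq hq hf hg

theorem measurePreserving_reflect (T : ℝ) :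
    MeasurePreserving (fun t => T - t) (volume.restrict (Ioo 0 T)) (volume.restrict (Ioo 0 T)) := by
  have := (Measure.measurePreserving_sub_left (volume : Measure ℝ) T).restrict_preimage
    (measurableSet_Ioo (a := (0 : ℝ)) (b := T))
  simpa using this

theorem rightRL_eq_leftRL (T γ : ℝ) (ψ : ℝ → ℝ) (t : ℝ) :
    rightRL T γ ψ (T - t) = leftRL 0 γ (fun s => ψ (T - s)) t := by
  unfold rightRL leftRL
  split_ifs
  · rfl
  · congr 1
    have := (Measure.measurePreserving_sub_left (volume : Measure ℝ) T).setIntegral_preimage_emb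
      (Homeomorph.subLeft T).measurableEmbedding
      (fun s => ψ s * (s - (T - t)) ^ (γ - 1)) (Ioo (T - t) T)
    simp only [preimage_const_sub_Ioo, sub_self, sub_sub_cancel] at this
    rw [← this]
    congr 1
    ext s
    congr 2
    ring

theorem IsRightDeriv.reflect {T γ : ℝ} {q : ℝ≥0∞} {g ψ : ℝ → ℝ} (h : IsRightDeriv 0 T γ q g ψ) :
    IsLeftDeriv 0 T γ q (fun t => g (T - t)) (fun t => ψ (T - t)) := by
  refine ⟨h.1.comp_measurePreserving (measurePreserving_reflect T), ?_⟩
  filter_upwards [(measurePreserving_reflect T).quasiMeasurePreserving.ae h.2] with t ht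
  rw [ht, rightRL_eq_leftRL]

theorem IsLeftDeriv.reflect {T γ : ℝ} {q : ℝ≥0∞} {g ψ : ℝ → ℝ}
    (h : IsLeftDeriv 0 T γ q (fun t => g (T - t)) ψ) :
    IsRightDeriv 0 T γ q g (fun t => ψ (T - t)) := by
  refine ⟨h.1.comp_measurePreserving (measurePreserving_reflect T), ?_⟩
  filter_upwards [(measurePreserving_reflect T).quasiMeasurePreserving.ae h.2] with t ht
  have h2 := rightRL_eq_leftRL T γ (fun t => ψ (T - t)) (T - t)
  simp only [sub_sub_cancel] at ht h2
  rw [ht, h2]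

theorem leftRL_eq_cv {T γ t : ℝ} (hγ : γ ≠ 0) (φ : ℝ → ℝ) (ht : t ≤ T) :
    leftRL 0 γ φ t = cv ((Ioo 0 T).indicator φ) (kern T γ) t := by
  rw [cv_kern_eq_setIntegral (fun s hs => indicator_of_notMem (fun h => absurd h.1 hs.not_gt) _) ht,
    leftRL, if_neg hγ]
  congr 1
  refine setIntegral_congr_fun measurableSet_Ioo fun s hs => ?_
  rw [indicator_of_mem (show s ∈ Ioo 0 T from ⟨hs.1, hs.2.trans_le ht⟩)]

theorem ae_Iio_of_ae_Ioo {T : ℝ} {f g : ℝ → ℝ} (hf : ∀ x ≤ 0, f x = 0) (hg : ∀ x ≤ 0, g x = 0)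
    (h : f =ᵐ[volume.restrict (Ioo 0 T)] g) : f =ᵐ[volume.restrict (Iio T)] g := by
  rw [EventuallyEq, ae_restrict_iff' measurableSet_Ioo] at h
  rw [EventuallyEq, ae_restrict_iff' measurableSet_Iio]
  filter_upwards [h] with x hx hxT
  rcases le_or_gt x 0 with h0 | h0
  · rw [hf x h0, hg x h0]
  · exact hx ⟨h0, hxT⟩

theorem indicator_Ioo_eq_zero {T : ℝ} (f : ℝ → ℝ) : ∀ x ≤ 0, (Ioo 0 T).indicator f x = 0 :=
  fun _ hx => indicator_of_notMem (fun h => absurd h.1 hx.not_gt) _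

theorem IsLeftDeriv.ae_eq_cv {T γ : ℝ} (hγ : 0 < γ) {p : ℝ≥0∞} (hp : 1 ≤ p) {h φ : ℝ → ℝ}
    (H : IsLeftDeriv 0 T γ p h φ) :
    (Ioo 0 T).indicator h =ᵐ[volume.restrict (Iio T)]
      cv ((Ioo 0 T).indicator φ) (kern T γ) := by
  refine ae_Iio_of_ae_Ioo (indicator_Ioo_eq_zero h)
    ((causal_indicator (H.1.integrable hp)).cv (causal_kern hγ)).eq_zero ?_
  filter_upwards [H.2, ae_restrict_mem measurableSet_Ioo] with x hx hxT
  rw [indicator_of_mem hxT, hx, leftRL_eq_cv hγ.ne' _ hxT.2.le]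

theorem IsLeftDeriv.ae_eq_of_order_zero {T : ℝ} {p : ℝ≥0∞} {h φ : ℝ → ℝ}
    (H : IsLeftDeriv 0 T 0 p h φ) :
    (Ioo 0 T).indicator h =ᵐ[volume.restrict (Iio T)] (Ioo 0 T).indicator φ := by
  refine ae_Iio_of_ae_Ioo (indicator_Ioo_eq_zero h) (indicator_Ioo_eq_zero φ) ?_
  filter_upwards [H.2, ae_restrict_mem measurableSet_Ioo] with x hx hxT
  rw [indicator_of_mem hxT, indicator_of_mem hxT, hx, leftRL, if_pos rfl]

/-- The kernels of orders `γ` and `1 - γ` convolve to the Heaviside function, so the right-hand side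
carries no trace of `γ`. -/
theorem cv_ae_eq_of_isLeftDeriv {T γ : ℝ} (hγ : γ ∈ Icc (0 : ℝ) 1) {p q : ℝ≥0∞} (hp : 1 ≤ p)
    (hq : 1 ≤ q) {h g φ ψ : ℝ → ℝ} (H : IsLeftDeriv 0 T γ p h φ)
    (G : IsLeftDeriv 0 T (1 - γ) q g ψ) :
    cv ((Ioo 0 T).indicator h) ((Ioo 0 T).indicator g) =ᵐ[volume.restrict (Iio T)]
      cv (cv ((Ioo 0 T).indicator φ) ((Ioo 0 T).indicator ψ)) (heav T) := by
  have hφ : Causal ((Ioo 0 T).indicator φ) := causal_indicator (H.1.integrable hp)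
  have hψ : Causal ((Ioo 0 T).indicator ψ) := causal_indicator (G.1.integrable hq)
  set Φ := (Ioo 0 T).indicator φ
  set Ψ := (Ioo 0 T).indicator ψ
  have assoc : ∀ {a b c : ℝ → ℝ}, Causal a → Causal b → Causal c →
      cv (cv a b) c =ᵐ[volume.restrict (Iio T)] cv a (cv b c) := fun ha hb hc =>
    ae_restrict_of_ae (cv_assoc_ae ha.integrable hb.integrable hc.integrable)
  -- At `γ = 0` and `γ = 1` one operator is the identity, which has no kernel function, and the
  -- other kernel is already the Heaviside function.
  rcases hγ.1.eq_or_lt with rfl | h0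
  · have E1 := H.ae_eq_of_order_zero
    have E2 := G.ae_eq_cv (by norm_num) hq
    rw [sub_zero, kern_one] at E2
    have hg : Causal ((Ioo 0 T).indicator g) := by
      refine ⟨?_, indicator_Ioo_eq_zero g⟩
      rw [integrable_indicator_iff measurableSet_Ioo]
      have : IntegrableOn (cv Ψ (heav T)) (Ioo 0 T) :=
        (hψ.cv (causal_heav T)).integrable.integrableOn
      refine this.congr ?_
      filter_upwards [ae_restrict_of_ae_restrict_of_subset Ioo_subset_Iio_self E2,
        ae_restrict_mem measurableSet_Ioo] with x hx hxT
      rw [← hx, indicator_of_mem hxT]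
    exact (cv_congr_left_ae hg E1).trans
      ((cv_congr_right_ae hφ E2).trans (assoc hφ hψ (causal_heav T)).symm)
  have E1 := H.ae_eq_cv h0 hp
  have hk := causal_kern (T := T) h0
  rcases hγ.2.eq_or_lt with rfl | h1
  · rw [sub_self] at G
    have E2 := G.ae_eq_of_order_zero
    rw [kern_one] at E1
    have hh := hφ.cv (causal_heav T)
    rw [cv_comm Φ Ψ]
    have hg : Causal ((Ioo 0 T).indicator g) := by
      refine ⟨?_, indicator_Ioo_eq_zero g⟩
      rw [integrable_indicator_iff measurableSet_Ioo]
      refine (G.1.integrable hq).congr ?_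
      filter_upwards [G.2] with x hx
      rw [hx, leftRL, if_pos rfl]
    refine (cv_congr_left_ae hg E1).trans ((cv_congr_right_ae hh E2).trans ?_)
    rw [cv_comm _ Ψ]
    exact (assoc hψ hφ (causal_heav T)).symm
  have E2 := G.ae_eq_cv (sub_pos.2 h1) hq
  have hk' := causal_kern (T := T) (sub_pos.2 h1)
  have hg : Causal ((Ioo 0 T).indicator g) := by
    refine ⟨?_, indicator_Ioo_eq_zero g⟩
    rw [integrable_indicator_iff measurableSet_Ioo]
    have : IntegrableOn (cv Ψ (kern T (1 - γ))) (Ioo 0 T) :=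
      (hψ.cv hk').integrable.integrableOn
    refine this.congr ?_
    filter_upwards [ae_restrict_of_ae_restrict_of_subset Ioo_subset_Iio_self E2,
      ae_restrict_mem measurableSet_Ioo] with x hx hxT
    rw [← hx, indicator_of_mem hxT]
  refine (cv_congr_left_ae hg E1).trans ((cv_congr_right_ae (hφ.cv hk) E2).trans ?_)
  refine (assoc hφ hk (hψ.cv hk')).trans ?_
  refine (cv_congr_right_ae hφ ?_).trans (assoc hφ hψ (causal_heav T)).symm
  rw [cv_comm Ψ]
  refine (assoc hk hk' hψ).symm.trans ?_
  rw [cv_comm Ψ]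
  exact cv_congr_left_ae hψ (cv_kern_kern_ae h0 h1)

theorem cv_reflect_apply (T : ℝ) (φ ψ : ℝ → ℝ) :
    cv ((Ioo 0 T).indicator φ) ((Ioo 0 T).indicator fun t => ψ (T - t)) T =
      ∫ t in Ioo 0 T, φ t * ψ t := by
  rw [cv_apply, ← integral_indicator measurableSet_Ioo]
  congr 1
  ext s
  by_cases hs : s ∈ Ioo 0 T
  · have : T - s ∈ Ioo 0 T := ⟨by linarith [hs.2], by linarith [hs.1]⟩
    simp [hs, this, -mem_Ioo]
  · simp [hs, -mem_Ioo]

/-- The value of the fractional Zähle-Stieltjes integral does not depend on the choice of the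
order, of the exponents and of the fractional derivatives. -/
theorem HasZSIntegral.unique {f g : ℝ → ℝ} {T v w : ℝ}
    (hv : HasZSIntegral f g 0 T v) (hw : HasZSIntegral f g 0 T w) : v = w := by
  obtain ⟨-, -, fa, ga, gb, hfa, hga, hgb, γ, hγ, p, q, hpq, φ, ψ, hφ, hψ, rfl⟩ := hv
  obtain ⟨-, -, fa', ga', gb', hfa', hga', hgb', γ', hγ', p', q', hpq', φ', ψ', hφ', hψ', rfl⟩ := hw
  obtain rfl := tendsto_nhds_unique hfa hfa'
  obtain rfl := tendsto_nhds_unique hga hga'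
  obtain rfl := tendsto_nhds_unique hgb hgb'
  have hp := ENNReal.HolderConjugate.one_le p q
  have hq := ENNReal.HolderConjugate.one_le q p
  have hp' := ENNReal.HolderConjugate.one_le p' q'
  have hq' := ENNReal.HolderConjugate.one_le q' p'
  have key := (cv_ae_eq_of_isLeftDeriv hγ hp hq hφ hψ.reflect).symm.trans
    (cv_ae_eq_of_isLeftDeriv hγ' hp' hq' hφ' hψ'.reflect)
  have h1 := ae_eq_of_cv_heav
    ((causal_indicator (hφ.1.integrable hp)).cv (causal_indicator (hψ.reflect.1.integrable hq)))
    ((causal_indicator (hφ'.1.integrable hp')).cv (causal_indicator (hψ'.reflect.1.integrable hq')))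
    key
  have c1 := continuous_cv hpq ((memLp_indicator_iff_restrict measurableSet_Ioo).2 hφ.1)
    ((memLp_indicator_iff_restrict measurableSet_Ioo).2 hψ.reflect.1)
  have c2 := continuous_cv hpq' ((memLp_indicator_iff_restrict measurableSet_Ioo).2 hφ'.1)
    ((memLp_indicator_iff_restrict measurableSet_Ioo).2 hψ'.reflect.1)
  have h2 := Measure.eqOn_open_of_ae_eq h1 isOpen_Iio c1.continuousOn c2.continuousOn
  -- Equality is known only below `T`; continuity carries it to `T` itself, where the convolution is
  -- the wanted integral.
  have h3 := h2.closure c1 c2 (show T ∈ closure (Iio T) by simp [closure_Iio])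
  rw [cv_reflect_apply, cv_reflect_apply] at h3
  rw [h3]

/-! ### Marchaud derivatives invert fractional integrals -/

/-- The integrand of the Marchaud derivative of order `γ`. -/
noncomputable def marchaudIntegrand (γ : ℝ) (h : ℝ → ℝ) (t u : ℝ) : ℝ :=
  (h t - h (t - u)) * u ^ (-1 - γ)

/-- The left-sided Marchaud derivative of order `γ`. -/
noncomputable def marchaud (γ : ℝ) (h : ℝ → ℝ) (t : ℝ) : ℝ :=
  γ / Real.Gamma (1 - γ) * ∫ u in Ioi 0, marchaudIntegrand γ h t u

/-- The translate integrates to the mass of `h` below `x - u`, so only the window between `x - u`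
and `x` survives. -/
theorem setIntegral_sub_translate {h : ℝ → ℝ} (hh : Causal h) {x u : ℝ} (hu : 0 < u) :
    ∫ t in Ioo 0 x, (h t - h (t - u)) = ∫ s in Ioo 0 x, (Ici (x - u)).indicator h s := by
  have hs : Integrable fun t => h (t - u) := hh.integrable.comp_sub_right u
  have e1 : ∀ k : ℝ → ℝ, (∀ s ≤ 0, k s = 0) → ∫ t in Ioo 0 x, k t = ∫ t in Iio x, k t := by
    intro k hk
    rw [← integral_indicator measurableSet_Ioo, ← integral_indicator measurableSet_Iio]
    congr 1
    ext t
    by_cases h0 : t ≤ 0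
    · rw [indicator_of_notMem fun h => absurd h.1 h0.not_gt]
      by_cases h1 : t < x
      · rw [indicator_of_mem (show t ∈ Iio x from h1), hk t h0]
      · rw [indicator_of_notMem (show t ∉ Iio x from h1)]
    · by_cases h1 : t < x
      · rw [indicator_of_mem (show t ∈ Iio x from h1), indicator_of_mem]
        exact ⟨by linarith, h1⟩
      · rw [indicator_of_notMem (show t ∉ Iio x from h1), indicator_of_notMem]
        exact fun h => h1 h.2
  have e2 : ∫ t in Iio x, h (t - u) = ∫ t in Iio x, (Iio (x - u)).indicator h t := by
    rw [setIntegral_indicator measurableSet_Iio,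
      inter_eq_self_of_subset_right (Iio_subset_Iio (by linarith : x - u ≤ x)),
      ← integral_indicator measurableSet_Iio, ← integral_indicator measurableSet_Iio,
      ← integral_sub_right_eq_self ((Iio (x - u)).indicator h) u]
    congr 1
    ext t
    by_cases h1 : t < x <;> simp [indicator, h1]
  rw [integral_sub hh.integrable.integrableOn hs.integrableOn, e1 h hh.eq_zero,
    e1 (fun t => h (t - u)) (fun s h0 => hh.eq_zero _ (by linarith)), e2,
    e1 ((Ici (x - u)).indicator h) (fun s h0 => by
      rw [indicator_apply_eq_zero]; exact fun _ => hh.eq_zero s h0),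
    ← integral_sub hh.integrable.integrableOn (hh.integrable.indicator measurableSet_Iio).integrableOn]
  congr 1
  ext t
  by_cases h1 : t < x - u
  · simp [h1, not_le.2 h1]
  · simp [h1, not_lt.1 h1]

theorem integral_indicator_Ici_rpow {γ a : ℝ} (hγ : 0 < γ) (ha : 0 < a) :
    ∫ u in Ioi 0, (Ici a).indicator (fun u : ℝ => u ^ (-1 - γ)) u = a ^ (-γ) / γ := by
  rw [setIntegral_indicator measurableSet_Ici,
    inter_eq_self_of_subset_right (show Ici a ⊆ Ioi 0 from fun u hu => lt_of_lt_of_le ha hu),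
    integral_Ici_eq_integral_Ioi, integral_Ioi_rpow_of_lt (by linarith) ha,
    show -1 - γ + 1 = -γ by ring, neg_div_neg_eq]

theorem integrableOn_indicator_Ici_rpow {γ a : ℝ} (hγ : 0 < γ) (ha : 0 < a) :
    IntegrableOn ((Ici a).indicator (fun u : ℝ => u ^ (-1 - γ))) (Ioi 0) := by
  refine Integrable.integrableOn ?_
  rw [integrable_indicator_iff measurableSet_Ici, integrableOn_Ici_iff_integrableOn_Ioi]
  exact integrableOn_Ioi_rpow_of_lt (by linarith) ha

theorem integrableOn_sub_rpow {γ x : ℝ} (hγ : γ < 1) :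
    IntegrableOn (fun s => (x - s) ^ (-γ)) (Ioo 0 x) := by
  have := (measurePreserving_reflect x).integrable_comp_of_integrable
    (integrableOn_rpow_Ioo (T := x) (r := -γ) (by linarith))
  exact this

/-- Justifies Fubini in `setIntegral_marchaud`: integrating out `u` leaves at most `M (x - s) ^ (-γ)
/ γ`, integrable since `γ < 1`. -/
theorem integrable_mul_rpow_indicator {γ x M : ℝ} {h : ℝ → ℝ} (h0 : 0 < γ) (h1 : γ < 1)
    (hh : Causal h) (hM : ∀ t, |h t| ≤ M) :
    Integrable (fun z : ℝ × ℝ => h z.2 * (Ici (x - z.2)).indicator (fun u => u ^ (-1 - γ)) z.1)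
      ((volume.restrict (Ioi 0)).prod (volume.restrict (Ioo 0 x))) := by
  have hm : AEStronglyMeasurable
      (fun z : ℝ × ℝ => h z.2 * (Ici (x - z.2)).indicator (fun u => u ^ (-1 - γ)) z.1)
      ((volume.restrict (Ioi 0)).prod (volume.restrict (Ioo 0 x))) := by
    refine hh.integrable.1.restrict.comp_snd.mul ?_
    have : (fun z : ℝ × ℝ => (Ici (x - z.2)).indicator (fun u : ℝ => u ^ (-1 - γ)) z.1) =
        {z : ℝ × ℝ | x - z.2 ≤ z.1}.indicator fun z => z.1 ^ (-1 - γ) := by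
      ext z
      simp [indicator]
    rw [this]
    refine (Measurable.indicator (by fun_prop) ?_).aestronglyMeasurable
    exact measurableSet_le (by fun_prop) (by fun_prop)
  rw [integrable_prod_iff' hm]
  constructor
  · filter_upwards [ae_restrict_mem measurableSet_Ioo] with s hs
    exact (integrableOn_indicator_Ici_rpow h0 (sub_pos.2 hs.2)).const_mul _
  · have hb : IntegrableOn (fun s => M * ((x - s) ^ (-γ) / γ)) (Ioo 0 x) :=
      ((integrableOn_sub_rpow h1).div_const _).const_mul _
    refine hb.mono' hm.norm.prod_swap.integral_prod_right' ?_
    filter_upwards [ae_restrict_mem measurableSet_Ioo] with s hs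
    have hpos : 0 < x - s := sub_pos.2 hs.2
    have e : ∫ u in Ioi 0, ‖h s * (Ici (x - s)).indicator (fun u => u ^ (-1 - γ)) u‖ =
        |h s| * ((x - s) ^ (-γ) / γ) := by
      rw [← integral_indicator_Ici_rpow h0 hpos, ← integral_const_mul]
      refine setIntegral_congr_fun measurableSet_Ioi fun u hu => ?_
      rw [norm_mul, Real.norm_eq_abs, Real.norm_eq_abs, abs_of_nonneg (a := indicator _ _ _)]
      exact indicator_nonneg (fun v hv => Real.rpow_nonneg (hpos.le.trans hv) _) _
    rw [Real.norm_eq_abs, e, abs_of_nonneg (by positivity)]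
    gcongr
    exact hM s

/-- Integrate in `t` before `u`: a point `s` is then counted exactly for `u ≥ x - s`, and the tail
of `u ^ (-1 - γ)` yields the kernel of order `1 - γ`. -/
theorem setIntegral_marchaud {T γ M x : ℝ} {h : ℝ → ℝ} (h0 : 0 < γ) (h1 : γ < 1) (hh : Causal h)
    (hM : ∀ t, |h t| ≤ M) (hxT : x ≤ T)
    (hJ : Integrable (Function.uncurry (marchaudIntegrand γ h))
      ((volume.restrict (Ioo 0 T)).prod (volume.restrict (Ioi 0)))) :
    ∫ t in Ioo 0 x, marchaud γ h t =
      (Real.Gamma (1 - γ))⁻¹ * ∫ s in Ioo 0 x, h s * (x - s) ^ (-γ) := by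
  have hJx : Integrable (Function.uncurry (marchaudIntegrand γ h))
      ((volume.restrict (Ioo 0 x)).prod (volume.restrict (Ioi 0))) :=
    hJ.mono_measure (Measure.prod_mono (Measure.restrict_mono (Ioo_subset_Ioo_right hxT) le_rfl) le_rfl)
  unfold marchaud
  rw [integral_const_mul, integral_integral_swap hJx]
  have e1 : ∀ u ∈ Ioi (0 : ℝ), ∫ t in Ioo 0 x, marchaudIntegrand γ h t u =
      ∫ s in Ioo 0 x, h s * (Ici (x - s)).indicator (fun u => u ^ (-1 - γ)) u := by
    intro u hu
    unfold marchaudIntegrand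
    rw [integral_mul_const, setIntegral_sub_translate hh hu, ← integral_mul_const]
    congr 1
    ext s
    by_cases hs : x - u ≤ s
    · rw [indicator_of_mem (show s ∈ Ici (x - u) from hs), indicator_of_mem]
      exact show x - s ≤ u by linarith
    · rw [indicator_of_notMem (show s ∉ Ici (x - u) from hs), indicator_of_notMem]
      · simp
      · exact fun h2 => hs (by linarith [show x - s ≤ u from h2])
  rw [setIntegral_congr_fun measurableSet_Ioi e1,
    integral_integral_swap (integrable_mul_rpow_indicator h0 h1 hh hM)]
  have e2 : ∀ s ∈ Ioo 0 x,
      ∫ u in Ioi 0, h s * (Ici (x - s)).indicator (fun u => u ^ (-1 - γ)) u =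
        γ⁻¹ * (h s * (x - s) ^ (-γ)) := by
    intro s hs
    rw [integral_const_mul, integral_indicator_Ici_rpow h0 (sub_pos.2 hs.2)]
    ring
  rw [setIntegral_congr_fun measurableSet_Ioo e2, integral_const_mul, ← mul_assoc]
  congr 1
  field_simp

/-- With `D` the Marchaud derivative, `I¹ D h = I^(1-γ) h`. Applying `I^γ` gives `I¹ (I^γ D h) = I¹
h`, and `I¹` is injective. -/
theorem ae_eq_cv_marchaud {T γ M : ℝ} {h : ℝ → ℝ} (h0 : 0 < γ) (h1 : γ < 1) (hh : Causal h)
    (hM : ∀ t, |h t| ≤ M)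
    (hJ : Integrable (Function.uncurry (marchaudIntegrand γ h))
      ((volume.restrict (Ioo 0 T)).prod (volume.restrict (Ioi 0)))) :
    IntegrableOn (marchaud γ h) (Ioo 0 T) ∧
    h =ᵐ[volume.restrict (Iio T)] cv ((Ioo 0 T).indicator (marchaud γ h)) (kern T γ) := by
  have hφ : IntegrableOn (marchaud γ h) (Ioo 0 T) := hJ.integral_prod_left.const_mul _
  refine ⟨hφ, ?_⟩
  have hΦ := causal_indicator hφ
  have hk := causal_kern (T := T) h0
  have hk' := causal_kern (T := T) (sub_pos.2 h1)
  have key : cv ((Ioo 0 T).indicator (marchaud γ h)) (heav T) =ᵐ[volume.restrict (Iio T)]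
      cv h (kern T (1 - γ)) := by
    filter_upwards [ae_restrict_mem measurableSet_Iio] with x hx
    rw [cv_heav_eq_setIntegral hΦ.eq_zero (le_of_lt hx),
      cv_kern_eq_setIntegral hh.eq_zero (le_of_lt hx), show 1 - γ - 1 = -γ by ring,
      ← setIntegral_marchaud h0 h1 hh hM (le_of_lt hx) hJ]
    refine setIntegral_congr_fun measurableSet_Ioo fun s hs => ?_
    exact indicator_of_mem (show s ∈ Ioo 0 T from ⟨hs.1, hs.2.trans hx⟩) _
  have assoc : ∀ {a b c : ℝ → ℝ}, Causal a → Causal b → Causal c →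
      cv (cv a b) c =ᵐ[volume.restrict (Iio T)] cv a (cv b c) := fun ha hb hc =>
    ae_restrict_of_ae (cv_assoc_ae ha.integrable hb.integrable hc.integrable)
  refine ae_eq_of_cv_heav hh (hΦ.cv hk) ?_
  have A : cv h (heav T) =ᵐ[volume.restrict (Iio T)] cv (cv h (kern T (1 - γ))) (kern T γ) := by
    refine EventuallyEq.trans ?_ (assoc hh hk' hk).symm
    rw [cv_comm (kern T (1 - γ))]
    exact cv_congr_right_ae hh (cv_kern_kern_ae h0 h1).symm
  refine A.trans ((cv_congr_left_ae hk key.symm).trans ((assoc hΦ (causal_heav T) hk).trans ?_))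
  rw [cv_comm (heav T)]
  exact (assoc hΦ hk (causal_heav T)).symm

theorem isLeftDeriv_marchaud {T γ M : ℝ} {p : ℝ≥0∞} {h : ℝ → ℝ} (h0 : 0 < γ) (h1 : γ < 1)
    (hm : AEStronglyMeasurable h (volume.restrict (Ioo 0 T)))
    (hM : ∀ t ∈ Ioo 0 T, |h t| ≤ M)
    (hJ : Integrable (Function.uncurry (marchaudIntegrand γ ((Ioo 0 T).indicator h)))
      ((volume.restrict (Ioo 0 T)).prod (volume.restrict (Ioi 0))))
    (hp : MemLp (marchaud γ ((Ioo 0 T).indicator h)) p (volume.restrict (Ioo 0 T))) :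
    IsLeftDeriv 0 T γ p h (marchaud γ ((Ioo 0 T).indicator h)) := by
  refine ⟨hp, ?_⟩
  have hi : IntegrableOn h (Ioo 0 T) := by
    refine Integrable.of_bound hm M ?_
    filter_upwards [ae_restrict_mem measurableSet_Ioo] with t ht using hM t ht
  have hM' : ∀ t, |(Ioo 0 T).indicator h t| ≤ |M| := by
    intro t
    by_cases ht : t ∈ Ioo 0 T
    · rw [indicator_of_mem ht]
      exact (hM t ht).trans (le_abs_self M)
    · rw [indicator_of_notMem ht, abs_zero]
      exact abs_nonneg M
  have h2 := (ae_eq_cv_marchaud h0 h1 (causal_indicator hi) hM' hJ).2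
  filter_upwards [ae_restrict_of_ae_restrict_of_subset Ioo_subset_Iio_self h2,
    ae_restrict_mem measurableSet_Ioo] with t ht htT
  rw [indicator_of_mem htT] at ht
  rw [ht, leftRL_eq_cv h0.ne' _ htT.2.le]

theorem aestronglyMeasurable_marchaudIntegrand {T γ : ℝ} {h : ℝ → ℝ}
    (hm : AEStronglyMeasurable h (volume.restrict (Ioo 0 T))) :
    AEStronglyMeasurable (Function.uncurry (marchaudIntegrand γ ((Ioo 0 T).indicator h)))
      ((volume.restrict (Ioo 0 T)).prod (volume.restrict (Ioi 0))) := by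
  have hG : AEStronglyMeasurable ((Ioo 0 T).indicator h) volume :=
    (aestronglyMeasurable_indicator_iff measurableSet_Ioo).2 hm
  have h2 : AEStronglyMeasurable (fun z : ℝ × ℝ => (Ioo 0 T).indicator h (z.1 - z.2))
      ((volume.restrict (Ioo 0 T)).prod (volume.restrict (Ioi 0))) :=
    (hG.comp_quasiMeasurePreserving (quasiMeasurePreserving_sub volume volume)).mono_measure
      (Measure.prod_mono Measure.restrict_le_self Measure.restrict_le_self)
  refine ((hG.restrict.comp_fst).sub h2).mul (Measurable.aestronglyMeasurable ?_)
  fun_prop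

/-! ### Criteria for fractional differentiability -/

theorem integrableOn_min_rpow_mul_rpow {T δ β : ℝ} (hT : 0 < T) (h0 : 0 < δ) (hβ : δ < β) :
    IntegrableOn (fun u => min u T ^ β * u ^ (-1 - δ)) (Ioi 0) := by
  rw [← Ioc_union_Ioi_eq_Ioi hT.le, integrableOn_union]
  constructor
  · rw [integrableOn_Ioc_iff_integrableOn_Ioo]
    refine (integrableOn_rpow_Ioo (r := β - 1 - δ) (by linarith)).congr_fun (fun u hu => ?_)
      measurableSet_Ioo
    simp only
    rw [min_eq_left hu.2.le, ← Real.rpow_add hu.1]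
    congr 1
    ring
  · have h2 : IntegrableOn (fun u : ℝ => T ^ β * u ^ (-1 - δ)) (Ioi T) :=
      (integrableOn_Ioi_rpow_of_lt (by linarith) hT).const_mul _
    refine h2.congr_fun (fun u hu => ?_) measurableSet_Ioi
    simp only
    rw [min_eq_right (le_of_lt hu)]

/-- A function that is Hölder continuous of order `β` and vanishes at the left end has a bounded
fractional derivative of every order below `β`. -/
theorem exists_isLeftDeriv_top {T δ β C : ℝ} {g : ℝ → ℝ} (hT : 0 < T) (h0 : 0 < δ) (h1 : δ < 1)
    (hβ : δ < β) (hC : 0 ≤ C)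
    (hg : ∀ s ∈ Icc 0 T, ∀ t ∈ Icc 0 T, |g t - g s| ≤ C * |t - s| ^ β)
    (hm : AEStronglyMeasurable g (volume.restrict (Ioo 0 T))) (hg0 : g 0 = 0) :
    ∃ ψ, IsLeftDeriv 0 T δ ∞ g ψ := by
  set G := (Ioo 0 T).indicator g with hGdef
  have h0T : (0 : ℝ) ∈ Icc 0 T := ⟨le_rfl, hT.le⟩
  have hbase : ∀ t ∈ Ioo 0 T, |g t| ≤ C * t ^ β := by
    intro t ht
    have := hg 0 h0T t ⟨ht.1.le, ht.2.le⟩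
    rwa [hg0, sub_zero, sub_zero, abs_of_pos ht.1] at this
  have hβ0 : 0 ≤ β := (h0.trans hβ).le
  have hb : ∀ t ∈ Ioo 0 T, ∀ u ∈ Ioi (0 : ℝ),
      ‖marchaudIntegrand δ G t u‖ ≤ C * (min u T ^ β * u ^ (-1 - δ)) := by
    intro t ht u hu
    have hu' : 0 < u := hu
    rw [marchaudIntegrand, norm_mul, Real.norm_of_nonneg (Real.rpow_nonneg hu'.le _), ← mul_assoc]
    refine mul_le_mul_of_nonneg_right ?_ (Real.rpow_nonneg hu'.le _)
    rw [Real.norm_eq_abs, hGdef, indicator_of_mem ht]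
    -- For `u ≥ t` the zero extension leaves only `g t`, which is controlled because `g 0 = 0`.
    rcases lt_or_ge u t with hut | hut
    · have h3 : t - u ∈ Ioo 0 T := ⟨by linarith, by linarith [ht.2]⟩
      rw [indicator_of_mem h3, min_eq_left (by linarith [ht.2])]
      have := hg (t - u) ⟨h3.1.le, h3.2.le⟩ t ⟨ht.1.le, ht.2.le⟩
      rwa [sub_sub_cancel, abs_of_pos hu'] at this
    · rw [indicator_of_notMem (fun h => by linarith [h.1]), sub_zero]
      refine (hbase t ht).trans (mul_le_mul_of_nonneg_left ?_ hC)
      exact Real.rpow_le_rpow ht.1.le (le_min hut ht.2.le) hβ0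
  have hW : IntegrableOn (fun u => C * (min u T ^ β * u ^ (-1 - δ))) (Ioi 0) :=
    (integrableOn_min_rpow_mul_rpow hT h0 hβ).const_mul C
  have hmJ := aestronglyMeasurable_marchaudIntegrand (γ := δ) hm
  have hJ : Integrable (Function.uncurry (marchaudIntegrand δ G))
      ((volume.restrict (Ioo 0 T)).prod (volume.restrict (Ioi 0))) := by
    have hdom : Integrable (fun z : ℝ × ℝ => (1 : ℝ) * (C * (min z.2 T ^ β * z.2 ^ (-1 - δ))))
        ((volume.restrict (Ioo 0 T)).prod (volume.restrict (Ioi 0))) :=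
      Integrable.mul_prod (f := fun _ : ℝ => (1 : ℝ)) (integrable_const 1) hW
    refine hdom.mono' hmJ ?_
    rw [Measure.prod_restrict]
    filter_upwards [ae_restrict_mem (measurableSet_Ioo.prod measurableSet_Ioi)] with z hz
    rw [one_mul]
    exact hb z.1 hz.1 z.2 hz.2
  refine ⟨_, isLeftDeriv_marchaud (M := C * T ^ β) h0 h1 hm (fun t ht => (hbase t ht).trans ?_)
    hJ ?_⟩
  · exact mul_le_mul_of_nonneg_left (Real.rpow_le_rpow ht.1.le ht.2.le hβ0) hC
  · refine memLp_top_of_bound (hJ.integral_prod_left.1.const_mul _)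
      (|δ / Real.Gamma (1 - δ)| * ∫ u in Ioi 0, C * (min u T ^ β * u ^ (-1 - δ))) ?_
    filter_upwards [ae_restrict_mem measurableSet_Ioo] with t ht
    rw [marchaud, norm_mul, Real.norm_eq_abs]
    refine mul_le_mul_of_nonneg_left ?_ (abs_nonneg _)
    refine norm_integral_le_of_norm_le hW ?_
    filter_upwards [ae_restrict_mem measurableSet_Ioi] with u hu using hb t ht u hu

/-- A bounded function with finite Gagliardo-type integral of order `γ` has an integrable
fractional derivative of order `γ`. -/
theorem exists_isLeftDeriv_one {T γ M : ℝ} {h : ℝ → ℝ} (h0 : 0 < γ) (h1 : γ < 1)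
    (hm : AEStronglyMeasurable h (volume.restrict (Ioo 0 T))) (hM : ∀ t ∈ Ioo 0 T, |h t| ≤ M)
    (hfin : ∫⁻ t in Ioo 0 T, ∫⁻ u in Ioo 0 t,
      ENNReal.ofReal (|h t - h (t - u)| * u ^ (-1 - γ)) ≠ ∞) :
    ∃ φ, IsLeftDeriv 0 T γ 1 h φ := by
  have hmJ := aestronglyMeasurable_marchaudIntegrand (γ := γ) hm
  have hJ : Integrable (Function.uncurry (marchaudIntegrand γ ((Ioo 0 T).indicator h)))
      ((volume.restrict (Ioo 0 T)).prod (volume.restrict (Ioi 0))) := by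
    refine ⟨hmJ, ?_⟩
    rw [HasFiniteIntegral, lintegral_prod _ hmJ.enorm]
    have hle : ∀ t ∈ Ioo 0 T, ∫⁻ u in Ioi 0,
        ‖Function.uncurry (marchaudIntegrand γ ((Ioo 0 T).indicator h)) (t, u)‖ₑ ≤
        (∫⁻ u in Ioo 0 t, ENNReal.ofReal (|h t - h (t - u)| * u ^ (-1 - γ))) +
          ENNReal.ofReal (M * (t ^ (-γ) / γ)) := by
      intro t ht
      have ht0 : 0 < t := ht.1
      have hM0 : 0 ≤ M := (abs_nonneg _).trans (hM t ht)
      -- The range `u ≥ t`, where the extension by zero enters, gives a boundary term of order `t ^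
      -- (-γ)`. It is integrable for `γ < 1`, so no decay of `h` at `0` is needed.
      rw [← Ioo_union_Ici_eq_Ioi ht0]
      refine (lintegral_union_le _ _ _).trans (add_le_add ?_ ?_)
      · refine lintegral_mono_ae ?_
        filter_upwards [ae_restrict_mem measurableSet_Ioo] with u hu
        have h3 : t - u ∈ Ioo 0 T := ⟨by linarith [hu.2], by linarith [ht.2, hu.1]⟩
        rw [Function.uncurry, marchaudIntegrand, indicator_of_mem ht, indicator_of_mem h3,
          ← ofReal_norm, norm_mul, Real.norm_eq_abs,
          Real.norm_of_nonneg (Real.rpow_nonneg hu.1.le _)]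
      · have e : ENNReal.ofReal (M * (t ^ (-γ) / γ)) =
            ∫⁻ u in Ici t, ENNReal.ofReal (M * u ^ (-1 - γ)) := by
          rw [← ofReal_integral_eq_lintegral_ofReal, integral_const_mul,
            integral_Ici_eq_integral_Ioi, integral_Ioi_rpow_of_lt (by linarith) ht0,
            show -1 - γ + 1 = -γ by ring, neg_div_neg_eq]
          · rw [← IntegrableOn, integrableOn_Ici_iff_integrableOn_Ioi]
            exact (integrableOn_Ioi_rpow_of_lt (by linarith) ht0).const_mul _
          · filter_upwards [ae_restrict_mem measurableSet_Ici] with u hu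
            exact mul_nonneg hM0 (Real.rpow_nonneg (ht0.le.trans hu) _)
        rw [e]
        refine lintegral_mono_ae ?_
        filter_upwards [ae_restrict_mem measurableSet_Ici] with u hu
        have hu0 : 0 < u := ht0.trans_le hu
        have h3 : t - u ∉ Ioo 0 T := fun h => by linarith [h.1, show t ≤ u from hu]
        rw [Function.uncurry, marchaudIntegrand, indicator_of_mem ht, indicator_of_notMem h3,
          ← ofReal_norm, norm_mul, Real.norm_eq_abs, sub_zero,
          Real.norm_of_nonneg (Real.rpow_nonneg hu0.le _)]
        exact ENNReal.ofReal_le_ofReal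
          (mul_le_mul_of_nonneg_right (hM t ht) (Real.rpow_nonneg hu0.le _))
    refine (lintegral_mono_ae (g := fun t => (∫⁻ u in Ioo 0 t,
      ENNReal.ofReal (|h t - h (t - u)| * u ^ (-1 - γ))) + ENNReal.ofReal (M * (t ^ (-γ) / γ)))
      ?_).trans_lt ?_
    · filter_upwards [ae_restrict_mem measurableSet_Ioo] with t ht using hle t ht
    · rw [lintegral_add_right _ (by fun_prop)]
      refine ENNReal.add_lt_top.2 ⟨hfin.lt_top, ?_⟩
      exact (((integrableOn_rpow_Ioo (T := T) (r := -γ)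
        (by linarith)).div_const γ).const_mul M).lintegral_lt_top
  refine ⟨_, isLeftDeriv_marchaud h0 h1 hm hM hJ ?_⟩
  rw [memLp_one_iff_integrable]
  exact hJ.integral_prod_left.const_mul _

/-! ### Increments of monotone functions along the process -/

/-- After shifting variables the two integrals cancel except on windows of length `2 r` around `N`
and `-N`, where `m` is bounded by its extreme values. -/
theorem lintegral_monotone_increment_le {m : ℝ → ℝ} (hm : Monotone m) {N r : ℝ} (hN : 0 ≤ N)
    (hr : 0 ≤ r) :
    ∫⁻ x in Icc (-N) N, ENNReal.ofReal (m (x + r) - m (x - r)) ≤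
      ENNReal.ofReal (2 * r * (m (N + r) - m (-N - r))) := by
  have hi : ∀ a b, IntervalIntegrable m volume a b := fun a b => hm.intervalIntegrable
  have hi1 : IntervalIntegrable (fun x => m (x + r)) volume (-N) N :=
    Monotone.intervalIntegrable fun x y h => hm (by linarith)
  have hi2 : IntervalIntegrable (fun x => m (x - r)) volume (-N) N :=
    Monotone.intervalIntegrable fun x y h => hm (by linarith)
  have hle : -N ≤ N := by linarith
  have hint : IntegrableOn (fun x => m (x + r) - m (x - r)) (Icc (-N) N) := by
    rw [integrableOn_Icc_iff_integrableOn_Ioc, ← intervalIntegrable_iff_integrableOn_Ioc_of_le hle]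
    exact hi1.sub hi2
  rw [← ofReal_integral_eq_lintegral_ofReal hint
    (Eventually.of_forall fun x => sub_nonneg.2 (hm (by linarith)))]
  refine ENNReal.ofReal_le_ofReal ?_
  rw [integral_Icc_eq_integral_Ioc, ← intervalIntegral.integral_of_le hle,
    intervalIntegral.integral_sub hi1 hi2, intervalIntegral.integral_comp_add_right,
    intervalIntegral.integral_comp_sub_right,
    intervalIntegral.integral_interval_sub_interval_comm' (hi _ _) (hi _ _) (hi _ _)]
  have h1 : ∫ x in (N - r)..(N + r), m x ≤ 2 * r * m (N + r) := by
    have := intervalIntegral.integral_mono_on (a := N - r) (b := N + r) (by linarith) (hi _ _)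
      (intervalIntegrable_const (c := m (N + r))) (fun x hx => hm hx.2)
    rw [intervalIntegral.integral_const, smul_eq_mul] at this
    linarith
  have h2 : 2 * r * m (-N - r) ≤ ∫ x in (-N - r)..(-N + r), m x := by
    have := intervalIntegral.integral_mono_on (a := -N - r) (b := -N + r) (by linarith)
      (intervalIntegrable_const (c := m (-N - r))) (hi _ _) (fun x hx => hm hx.1)
    rw [intervalIntegral.integral_const, smul_eq_mul] at this
    linarith
  linarith

/-- The fractional integral of the increments of `m` on balls around `x` of radius `N u ^ α`,
cut off outside `[-N, N]`. -/
noncomputable def incr (T α γ N : ℝ) (m : ℝ → ℝ) (x : ℝ) : ℝ≥0∞ :=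
  (Icc (-N) N).indicator (fun x => ∫⁻ u in Ioo 0 T,
    ENNReal.ofReal ((m (x + N * u ^ α) - m (x - N * u ^ α)) * u ^ (-1 - γ))) x

theorem measurable_incr_integrand (α γ N : ℝ) {m : ℝ → ℝ} (hm : Monotone m) :
    Measurable fun z : ℝ × ℝ =>
      ENNReal.ofReal ((m (z.1 + N * z.2 ^ α) - m (z.1 - N * z.2 ^ α)) * z.2 ^ (-1 - γ)) := by
  have := hm.measurable
  fun_prop

theorem measurable_incr (T α γ N : ℝ) {m : ℝ → ℝ} (hm : Monotone m) :
    Measurable (incr T α γ N m) :=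
  (measurable_incr_integrand α γ N hm).lintegral_prod_right'.indicator measurableSet_Icc

/-- By Tonelli, the integral over `x` gains a factor `u ^ α`, leaving `u ^ (α - 1 - γ)`, integrable
at zero because `γ < α`. -/
theorem lintegral_incr_lt_top {T α γ N : ℝ} (hα : 0 < α) (hγ : γ < α) (hN : 0 ≤ N)
    {m : ℝ → ℝ} (hm : Monotone m) : ∫⁻ x, incr T α γ N m x < ∞ := by
  unfold incr
  rw [lintegral_indicator measurableSet_Icc,
    lintegral_lintegral_swap (measurable_incr_integrand α γ N hm).aemeasurable]
  set R := N * T ^ α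
  set D := m (N + R) - m (-N - R)
  have hb : ∀ u ∈ Ioo 0 T, ∫⁻ x in Icc (-N) N,
      ENNReal.ofReal ((m (x + N * u ^ α) - m (x - N * u ^ α)) * u ^ (-1 - γ)) ≤
        ENNReal.ofReal (2 * N * D * u ^ (α - 1 - γ)) := by
    intro u hu
    have hu0 : 0 < u := hu.1
    have hr : 0 ≤ N * u ^ α := by positivity
    have hrR : N * u ^ α ≤ R :=
      mul_le_mul_of_nonneg_left (Real.rpow_le_rpow hu0.le hu.2.le hα.le) hN
    have hp : 0 ≤ u ^ (-1 - γ) := by positivity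
    have hD : m (N + N * u ^ α) - m (-N - N * u ^ α) ≤ D :=
      sub_le_sub (hm (by linarith)) (hm (by linarith))
    calc _ = (∫⁻ x in Icc (-N) N, ENNReal.ofReal (m (x + N * u ^ α) - m (x - N * u ^ α))) *
          ENNReal.ofReal (u ^ (-1 - γ)) := by
          have := hm.measurable
          rw [← lintegral_mul_const _ (by fun_prop)]
          congr 1
          ext x
          rw [ENNReal.ofReal_mul' hp]
      _ ≤ ENNReal.ofReal (2 * (N * u ^ α) * (m (N + N * u ^ α) - m (-N - N * u ^ α))) *
          ENNReal.ofReal (u ^ (-1 - γ)) := by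
          gcongr
          exact lintegral_monotone_increment_le hm hN hr
      _ ≤ ENNReal.ofReal (2 * (N * u ^ α) * D) * ENNReal.ofReal (u ^ (-1 - γ)) := by
          gcongr
      _ = _ := by
          rw [← ENNReal.ofReal_mul' hp]
          congr 1
          rw [show α - 1 - γ = α + (-1 - γ) by ring, Real.rpow_add hu0]
          ring
  refine (lintegral_mono_ae (g := fun u => ENNReal.ofReal (2 * N * D * u ^ (α - 1 - γ)))
    ?_).trans_lt ?_
  · filter_upwards [ae_restrict_mem measurableSet_Ioo] with u hu using hb u hu
  · exact ((integrableOn_rpow_Ioo (by linarith)).const_mul _).lintegral_lt_top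

theorem ofReal_increment_le {T α γ N : ℝ} {m x : ℝ → ℝ} (hm : Monotone m) {t : ℝ} (htT : t < T)
    (hN : |x t| ≤ N)
    (hx : ∀ u ∈ Ioo 0 t, |x t - x (t - u)| ≤ N * u ^ α) :
    ∫⁻ u in Ioo 0 t, ENNReal.ofReal (|m (x t) - m (x (t - u))| * u ^ (-1 - γ)) ≤
      incr T α γ N m (x t) := by
  rw [incr, indicator_of_mem (show x t ∈ Icc (-N) N from abs_le.1 hN)]
  refine le_trans (lintegral_mono_ae ?_)
    (lintegral_mono_set (Ioo_subset_Ioo_right htT.le))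
  filter_upwards [ae_restrict_mem measurableSet_Ioo] with u hu
  refine ENNReal.ofReal_le_ofReal
    (mul_le_mul_of_nonneg_right ?_ (Real.rpow_nonneg hu.1.le _))
  have h := abs_le.1 (hx u hu)
  have hr : 0 ≤ N * u ^ α := (abs_nonneg _).trans (hx u hu)
  have h1 : m (x t - N * u ^ α) ≤ m (x (t - u)) := hm (by linarith [h.2])
  have h2 : m (x (t - u)) ≤ m (x t + N * u ^ α) := hm (by linarith [h.1])
  have h3 : m (x t - N * u ^ α) ≤ m (x t) := hm (by linarith)
  have h4 : m (x t) ≤ m (x t + N * u ^ α) := hm (by linarith)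
  rw [abs_le]
  constructor <;> linarith

variable {Ω : Type*} [MeasurableSpace Ω]

/-- The expected occupation integral of `b` is at most `∫ phat` times `∫ b`, hence finite. -/
theorem HasBoundedDensities.ae_lintegral_comp_lt_top {P : Measure Ω} [IsProbabilityMeasure P]
    {T : ℝ} (hT : 0 < T) {X : ℝ → Ω → ℝ} (hd : HasBoundedDensities P T X)
    (hX : ∀ t ∈ Icc 0 T, Measurable (X t))
    (hc : ∀ᵐ ω ∂P, ContinuousOn (fun t => X t ω) (Icc 0 T))
    {b : ℝ → ℝ≥0∞} (hb : Measurable b) (hbi : ∫⁻ x, b x < ∞) :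
    ∀ᵐ ω ∂P, ∫⁻ t in Ioo 0 T, b (X t ω) < ∞ := by
  obtain ⟨phat, hphat, hp⟩ := hd
  obtain ⟨S, hSsub, hSm, hS⟩ := exists_measurable_superset_of_null hc
  -- A modification with all paths continuous: zero on a null set, frozen outside `[0, T]`. It is
  -- jointly measurable, as Tonelli requires.
  let Z : ℝ → Ω → ℝ := fun t => Sᶜ.indicator (X (projIcc 0 T hT.le t))
  have hZ : Measurable (Function.uncurry Z) := by
    refine measurable_uncurry_of_continuous_of_measurable (fun ω => ?_) fun t =>
      (hX _ (projIcc 0 T hT.le t).2).indicator hSm.compl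
    by_cases hω : ω ∈ S
    · simp only [Z, indicator_of_notMem (show ω ∉ Sᶜ from not_not.2 hω)]
      exact continuous_const
    · simp only [Z, indicator_of_mem (show ω ∈ Sᶜ from hω)]
      have : ContinuousOn (fun t => X t ω) (Icc 0 T) := by
        by_contra h
        exact hω (hSsub h)
      exact this.domRestrict.comp continuous_projIcc
  have hZX : ∀ ω ∉ S, ∀ t ∈ Icc 0 T, Z t ω = X t ω := by
    intro ω hω t ht
    simp only [Z, indicator_of_mem (show ω ∈ Sᶜ from hω), projIcc_of_mem hT.le ht]
  have hSae : ∀ᵐ ω ∂P, ω ∉ S := by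
    rw [ae_iff]
    simpa using hS
  have hbZ : Measurable fun z : ℝ × Ω => b (Z z.1 z.2) := hb.comp hZ
  have hfin : ∫⁻ ω, (∫⁻ t in Ioo 0 T, b (Z t ω)) ∂P < ∞ := by
    rw [lintegral_lintegral_swap (f := fun ω t => b (Z t ω))
      (hbZ.comp measurable_swap).aemeasurable]
    have hle : ∫⁻ t in Ioo 0 T, ∫⁻ ω, b (Z t ω) ∂P ≤
        ∫⁻ t in Ioo 0 T, ENNReal.ofReal (phat t) * ∫⁻ x, b x := by
      refine lintegral_mono_ae ?_
      filter_upwards [ae_restrict_of_ae_restrict_of_subset Ioo_subset_Icc_self hp,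
        ae_restrict_mem measurableSet_Ioo] with t ⟨p, hpm, hpb, hpd⟩ ht
      calc ∫⁻ ω, b (Z t ω) ∂P = ∫⁻ ω, b (X t ω) ∂P := by
            refine lintegral_congr_ae ?_
            filter_upwards [hSae] with ω hω
            rw [hZX ω hω t (Ioo_subset_Icc_self ht)]
        _ = ∫⁻ x, b x ∂(P.map (X t)) :=
            (lintegral_map hb (hX t (Ioo_subset_Icc_self ht))).symm
        _ = ∫⁻ x, ENNReal.ofReal (p x) * b x := by
            rw [hpd, lintegral_withDensity_eq_lintegral_mul _ hpm.ennreal_ofReal hb]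
            rfl
        _ ≤ ∫⁻ x, ENNReal.ofReal (phat t) * b x := by
            gcongr with x
            exact (hpb x).2
        _ = _ := lintegral_const_mul _ hb
    refine hle.trans_lt ?_
    rw [lintegral_mul_const' _ _ hbi.ne]
    exact ENNReal.mul_lt_top (hphat.mono_set Ioo_subset_Icc_self).lintegral_lt_top hbi
  filter_upwards [ae_lt_top (hbZ.comp measurable_swap).lintegral_prod_right' hfin.ne, hSae]
    with ω h1 h2
  refine lt_of_eq_of_lt ?_ h1
  refine setLIntegral_congr_fun measurableSet_Ioo fun t ht => ?_
  simp only [Function.comp, Prod.swap]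
  rw [hZX ω h2 t (Ioo_subset_Icc_self ht)]

/-! ### Pathwise existence and conclusion -/

theorem abs_sub_le_of_holderOnWith {T : ℝ} {C r : ℝ≥0} {x : ℝ → ℝ}
    (hx : HolderOnWith C r x (Icc 0 T)) :
    ∀ s ∈ Icc 0 T, ∀ t ∈ Icc 0 T, |x t - x s| ≤ C * |t - s| ^ (r : ℝ) := by
  intro s hs t ht
  have := hx t ht s hs
  rw [edist_nndist, edist_nndist, ← ENNReal.coe_rpow_of_nonneg _ r.coe_nonneg, ← ENNReal.coe_mul,
    ENNReal.coe_le_coe, ← NNReal.coe_le_coe] at this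
  simpa [Real.dist_eq] using this

theorem measurable_restrict_Ioo {T : ℝ} {x : ℝ → ℝ} (hx : ContinuousOn x (Icc 0 T)) :
    Measurable fun t : Ioo 0 T => x t :=
  (hx.mono Ioo_subset_Icc_self).domRestrict.measurable

theorem aestronglyMeasurable_of_subtype {T : ℝ} {h : ℝ → ℝ}
    (hh : Measurable fun t : Ioo 0 T => h t) :
    AEStronglyMeasurable h (volume.restrict (Ioo 0 T)) :=
  ((aemeasurable_restrict_iff_comap_subtype measurableSet_Ioo).2 hh.aemeasurable).aestronglyMeasurable

/-- The pathwise existence result: the composition of a function of locally finite variation with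
a Hölder path whose occupation density integrates the increments has a Zähle-Stieltjes integral
against a Hölder path. -/
theorem zsIntegralExists_of_incr {T α β γ N C : ℝ} {m₁ m₂ x y : ℝ → ℝ} (hT : 0 < T)
    (h0 : 0 < γ) (h1 : γ < 1) (hβ : 1 - γ < β) (hC : 0 ≤ C)
    (hm₁ : Monotone m₁) (hm₂ : Monotone m₂)
    (hxc : ContinuousOn x (Icc 0 T)) (hyc : ContinuousOn y (Icc 0 T))
    (hxN : ∀ t ∈ Icc 0 T, |x t| ≤ N)
    (hx : ∀ s ∈ Icc 0 T, ∀ t ∈ Icc 0 T, |x t - x s| ≤ N * |t - s| ^ α)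
    (hy : ∀ s ∈ Icc 0 T, ∀ t ∈ Icc 0 T, |y t - y s| ≤ C * |t - s| ^ β)
    (hi₁ : ∫⁻ t in Ioo 0 T, incr T α γ N m₁ (x t) < ∞)
    (hi₂ : ∫⁻ t in Ioo 0 T, incr T α γ N m₂ (x t) < ∞)
    {l : ℝ} (hl : Tendsto (fun t => m₁ (x t) - m₂ (x t)) (𝓝[>] 0) (𝓝 l)) :
    ZSIntegralExists (fun t => m₁ (x t) - m₂ (x t)) y 0 T := by
  have h0T : (0 : ℝ) ∈ Icc 0 T := ⟨le_rfl, hT.le⟩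
  have hTT : T ∈ Icc 0 T := ⟨hT.le, le_rfl⟩
  have hxm := measurable_restrict_Ioo hxc
  have hfm : Measurable fun t : Ioo 0 T => m₁ (x t) - m₂ (x t) :=
    (hm₁.measurable.comp hxm).sub (hm₂.measurable.comp hxm)
  have hym := measurable_restrict_Ioo hyc
  have hbdd : ∀ m : ℝ → ℝ, Monotone m → ∀ t ∈ Ioo 0 T, |m (x t)| ≤ |m N| + |m (-N)| := by
    intro m hm t ht
    have h := abs_le.1 (hxN t (Ioo_subset_Icc_self ht))
    have h2 := hm h.1
    have h3 := hm h.2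
    rw [abs_le]
    constructor
    · linarith [neg_abs_le (m (-N)), abs_nonneg (m N)]
    · linarith [le_abs_self (m N), abs_nonneg (m (-N))]
  have hpart : ∀ m : ℝ → ℝ, Monotone m → ∀ t ∈ Ioo 0 T,
      ∫⁻ u in Ioo 0 t, ENNReal.ofReal (|m (x t) - m (x (t - u))| * u ^ (-1 - γ)) ≤
        incr T α γ N m (x t) := by
    intro m hm t ht
    refine ofReal_increment_le hm ht.2 (hxN t (Ioo_subset_Icc_self ht)) fun u hu => ?_
    have := hx (t - u) ⟨by linarith [hu.2], by linarith [hu.1, ht.2]⟩ t (Ioo_subset_Icc_self ht)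
    rwa [sub_sub_cancel, abs_of_pos hu.1] at this
  have hxu : ∀ t ∈ Ioo 0 T, AEMeasurable (fun u => x (t - u)) (volume.restrict (Ioo 0 t)) := by
    intro t ht
    refine ContinuousOn.aemeasurable ?_ measurableSet_Ioo
    refine hxc.comp (by fun_prop) fun u hu => ⟨by linarith [hu.2], by linarith [hu.1, ht.2]⟩
  obtain ⟨φ, hφ⟩ : ∃ φ, IsLeftDeriv 0 T γ 1 (fun t => m₁ (x t) - m₂ (x t) - l) φ := by
    refine exists_isLeftDeriv_one
      (M := (|m₁ N| + |m₁ (-N)|) + (|m₂ N| + |m₂ (-N)|) + |l|) h0 h1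
      (aestronglyMeasurable_of_subtype (hfm.sub_const l)) (fun t ht => ?_) ?_
    · refine (abs_sub _ _).trans (add_le_add_left ((abs_sub _ _).trans ?_) _)
      exact add_le_add (hbdd m₁ hm₁ t ht) (hbdd m₂ hm₂ t ht)
    · refine ne_of_lt ?_
      have hle : ∀ t ∈ Ioo 0 T, ∫⁻ u in Ioo 0 t, ENNReal.ofReal
          (|m₁ (x t) - m₂ (x t) - l - (m₁ (x (t - u)) - m₂ (x (t - u)) - l)| * u ^ (-1 - γ)) ≤
          incr T α γ N m₁ (x t) + incr T α γ N m₂ (x t) := by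
        intro t ht
        refine le_trans ?_ (add_le_add (hpart m₁ hm₁ t ht) (hpart m₂ hm₂ t ht))
        have hmeas : AEMeasurable (fun u => |m₁ (x t) - m₁ (x (t - u))| * u ^ (-1 - γ))
            (volume.restrict (Ioo 0 t)) :=
          ((hm₁.measurable.comp_aemeasurable (hxu t ht)).const_sub _).norm.mul (by fun_prop)
        rw [← lintegral_add_left' hmeas.ennreal_ofReal]
        refine lintegral_mono_ae ?_
        filter_upwards [ae_restrict_mem measurableSet_Ioo] with u hu
        have hp : 0 ≤ u ^ (-1 - γ) := Real.rpow_nonneg hu.1.le _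
        rw [← ENNReal.ofReal_add (by positivity) (by positivity), ← add_mul]
        refine ENNReal.ofReal_le_ofReal (mul_le_mul_of_nonneg_right ?_ hp)
        refine le_trans (le_of_eq ?_) (abs_sub _ _)
        congr 1
        ring
      refine (lintegral_mono_ae (g := fun t => incr T α γ N m₁ (x t) + incr T α γ N m₂ (x t))
        ?_).trans_lt ?_
      · filter_upwards [ae_restrict_mem measurableSet_Ioo] with t ht using hle t ht
      · rw [lintegral_add_left']
        · exact ENNReal.add_lt_top.2 ⟨hi₁, hi₂⟩
        · exact (measurable_incr T α γ N hm₁).comp_aemeasurable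
            (aestronglyMeasurable_of_subtype hxm).aemeasurable
  have hrefl : ∀ t ∈ Icc 0 T, T - t ∈ Icc 0 T := fun t ht =>
    ⟨by linarith [ht.2], by linarith [ht.1]⟩
  -- Reflection moves the base point `T` to `0`, where the recentred path vanishes.
  obtain ⟨ψ, hψ⟩ : ∃ ψ, IsLeftDeriv 0 T (1 - γ) ∞ (fun t => y (T - t) - y T) ψ := by
    have hc : ContinuousOn (fun t => y (T - t)) (Icc 0 T) := hyc.comp (by fun_prop) hrefl
    refine exists_isLeftDeriv_top hT (by linarith) (by linarith) hβ hC (fun s hs t ht => ?_)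
      (aestronglyMeasurable_of_subtype ((measurable_restrict_Ioo hc).sub_const _)) (by simp)
    have := hy (T - s) (hrefl s hs) (T - t) (hrefl t ht)
    rwa [show T - t - (T - s) = -(t - s) by ring, abs_neg, ← sub_sub_sub_cancel_right _ _ (y T)]
      at this
  have hlim0 : Tendsto y (𝓝[>] 0) (𝓝 (y 0)) := by
    rw [← nhdsWithin_Ioo_eq_nhdsGT hT]
    exact (hyc 0 h0T).mono Ioo_subset_Icc_self
  have hlimT : Tendsto y (𝓝[<] T) (𝓝 (y T)) := by
    rw [← nhdsWithin_Ioo_eq_nhdsLT hT]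
    exact (hyc T hTT).mono Ioo_subset_Icc_self
  have hval : HasZSIntegral (fun t => m₁ (x t) - m₂ (x t)) y 0 T
      (-(∫ t in Ioo 0 T, φ t * ψ (T - t)) + l * (y T - y 0)) :=
    ⟨hfm, hym, l, y 0, y T, hl, hlim0, hlimT, γ, ⟨h0.le, h1.le⟩, 1, ∞, inferInstance, φ,
      fun t => ψ (T - t), hφ, hψ.reflect (g := fun t => y t - y T), rfl⟩
  exact ⟨_, hval, fun w hw => hw.unique hval⟩

end ZahleStieltjes

theorem theorem1 {Ω : Type*} [MeasurableSpace Ω] (P : Measure Ω) [IsProbabilityMeasure P]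
    (T : ℝ) (hT : 0 < T) (α β : ℝ≥0) (hα : 0 < α) (hβ : 0 < β) (hαβ : 1 < α + β)
    (X Y : ℝ → Ω → ℝ)
    (hX : ZahleStieltjes.IsHolderProcess P T α X)
    (hY : ZahleStieltjes.IsHolderProcess P T β Y)
    (hdens : ZahleStieltjes.HasBoundedDensities P T X)
    (f : ℝ → ℝ) (hf : LocallyBoundedVariationOn f Set.univ)
    (hf0 : ∀ᵐ ω ∂P, ∃ l : ℝ, Tendsto (fun t => f (X t ω)) (𝓝[>] 0) (𝓝 l)) :
    ∀ᵐ ω ∂P, ZahleStieltjes.ZSIntegralExists (fun t => f (X t ω)) (fun t => Y t ω) 0 T := by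
  obtain ⟨m₁, m₂, hm₁, hm₂, rfl⟩ := hf.exists_monotoneOn_sub_monotoneOn
  rw [monotoneOn_univ] at hm₁ hm₂
  have hα' : (0 : ℝ) < α := hα
  have hβ' : (0 : ℝ) < β := hβ
  have hαβ' : (1 : ℝ) < α + β := by exact_mod_cast hαβ
  -- The interval is nonempty exactly because `α`, `β` are positive and `1 - β < α`.
  obtain ⟨γ, hγ, hγ'⟩ : ∃ γ : ℝ, max 0 (1 - (β : ℝ)) < γ ∧ γ < min (α : ℝ) 1 :=
    exists_between (max_lt (lt_min hα' one_pos) (lt_min (by linarith) (by linarith)))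
  rw [max_lt_iff] at hγ
  rw [lt_min_iff] at hγ'
  have hcont : ∀ᵐ ω ∂P, ContinuousOn (fun t => X t ω) (Icc 0 T) := by
    filter_upwards [hX.2] with ω ⟨C, hC⟩ using hC.continuousOn hα
  -- The Hölder constant is random, so the almost sure bound is taken for all natural `N` at once.
  have hfin : ∀ m : ℝ → ℝ, Monotone m → ∀ᵐ ω ∂P, ∀ N : ℕ,
      ∫⁻ t in Ioo 0 T, ZahleStieltjes.incr T α γ N m (X t ω) < ∞ := fun m hm =>
    ae_all_iff.2 fun N => hdens.ae_lintegral_comp_lt_top hT hX.1 hcont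
      (ZahleStieltjes.measurable_incr T α γ N hm)
      (ZahleStieltjes.lintegral_incr_lt_top hα' hγ'.1 N.cast_nonneg hm)
  filter_upwards [hX.2, hY.2, hf0, hfin m₁ hm₁, hfin m₂ hm₂]
    with ω ⟨A, hA⟩ ⟨B, hB⟩ ⟨l, hl⟩ h₁ h₂
  have hxc := hA.continuousOn hα
  obtain ⟨K, hK⟩ := isCompact_Icc.exists_bound_of_continuousOn hxc
  -- One `N` bounds both the path and its Hölder constant, as `incr` uses it both as cutoff and as
  -- radius factor.
  obtain ⟨N, hN⟩ := exists_nat_ge (max K A)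
  rw [max_le_iff] at hN
  refine ZahleStieltjes.zsIntegralExists_of_incr (C := B) hT hγ.1 hγ'.2 (by linarith [hγ.2])
    B.coe_nonneg hm₁ hm₂ hxc (hB.continuousOn hβ) (fun t ht => (hK t ht).trans hN.1)
    (fun s hs t ht => ?_) (ZahleStieltjes.abs_sub_le_of_holderOnWith hB) (h₁ N) (h₂ N) hl
  exact (ZahleStieltjes.abs_sub_le_of_holderOnWith hA s hs t ht).trans
    (mul_le_mul_of_nonneg_right hN.2 (Real.rpow_nonneg (abs_nonneg _) _))
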